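/- All spaces are real. For a bounded linear operator $T:X\to Y$ between Banach spaces let $M_T=\{x\in X:\|x\|=1,\ \|Tx\|=\|T\|\}$ denote its norm attainment set. Let $\|T\|=1$ and $\varepsilon>0$. An operator $A:X\to Y$ with $\|A\|=1$ is called a uniform $\varepsilon$-BPB approximation of $T$ if there is $\delta>0$ such that for every $x_0\in X$ with $\|x_0\|=1$ and $\|Tx_0\|>1-\delta$ there is $u_0\in M_A$ with $\|u_0-x_0\|<\varepsilon$ and $\|T-A\|<\varepsilon$; it is called non-trivial if moreover $A\neq T$. The pair $(X,Y)$ has the non-trivial norm preserving uniform BPB approximation property if for every bounded linear $T:X\to Y$ with $\|T\|=1$ that is not an isometry and for every $\varepsilon>0$ there is a non-trivial uniform $\varepsilon$-BPB approximation $A_\varepsilon$ of $T$ with $M_{A_\varepsilon}=M_T$. An extreme contraction is an extreme point of the closed unit ball of the space of bounded linear operators $X\to Y$ with the operator norm. (a) Let $T:\ell_\infty^3\to\ell_1^3$ be an extreme contraction. Then for each $\varepsilon>0$, $T$ admits a non-trivial uniform $\varepsilon$-BPB approximation $A_\varepsilon$ with $M_{A_\varepsilon}=M_T$. (b) The pair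 $(\ell_\infty^3,\ell_1^3)$ has the non-trivial norm preserving uniform BPB approximation property. -/

import Mathlib

open scoped ENNReal

namespace UniformBPB

/-- The space `ℝⁿ` with the `ℓ_p` norm. -/
abbrev ell (p : ℝ≥0∞) (n : ℕ) : Type := PiLp p (fun _ : Fin n => ℝ)

section

variable {X Y : Type*} [NormedAddCommGroup X] [NormedSpace ℝ X]
  [NormedAddCommGroup Y] [NormedSpace ℝ Y]

/-- The norm attainment set `M_T = {x ∈ S_X : ‖T x‖ = ‖T‖}`. -/
def normAttainmentSet (T : X →L[ℝ] Y) : Set X :=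
  {x | ‖x‖ = 1 ∧ ‖T x‖ = ‖T‖}

/-- `T` is an extreme point of the closed unit ball of the space of bounded operators. -/
def IsExtremeContraction (T : X →L[ℝ] Y) : Prop :=
  T ∈ Set.extremePoints ℝ (Metric.closedBall (0 : X →L[ℝ] Y) 1)

/-- The norm one operator `A` is a uniform `ε`-BPB approximation of the norm one operator `T`. -/
def IsUniformBPBApprox (ε : ℝ) (T A : X →L[ℝ] Y) : Prop :=
  ‖T‖ = 1 ∧ ‖A‖ = 1 ∧
    ∃ δ : ℝ, 0 < δ ∧ ∀ x₀ : X, ‖x₀‖ = 1 → 1 - δ < ‖T x₀‖ →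
      ∃ u₀ ∈ normAttainmentSet A, ‖u₀ - x₀‖ < ε ∧ ‖T - A‖ < ε

/-- A uniform `ε`-BPB approximation of `T` which is different from `T`. -/
def IsNontrivialUniformBPBApprox (ε : ℝ) (T A : X →L[ℝ] Y) : Prop :=
  IsUniformBPBApprox ε T A ∧ A ≠ T

end

/-- The pair `(X, Y)` has the non-trivial norm preserving uniform BPB approximation property:
every norm one operator which is not an isometry has, for every `ε > 0`, a non-trivial uniform
`ε`-BPB approximation with the same norm attainment set. -/
def HasNontrivialNormPreservingUniformBPB (X Y : Type*)
    [NormedAddCommGroup X] [NormedSpace ℝ X] [NormedAddCommGroup Y] [NormedSpace ℝ Y] : Prop :=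
  ∀ T : X →L[ℝ] Y, ‖T‖ = 1 → ¬ Isometry T → ∀ ε : ℝ, 0 < ε →
    ∃ A : X →L[ℝ] Y, IsNontrivialUniformBPBApprox ε T A ∧
      normAttainmentSet T = normAttainmentSet A

end UniformBPB

/-! In finite dimension, compactness turns `‖T - A‖ < ε` and `M_A = M_T` into a uniform
approximation, so only a small norm-one change of `T` keeping `M_T` is needed. If `T` is not
extreme, move it slightly towards another point of its face. If one coordinate of `T` vanishes,
shift a small multiple of a nonzero coordinate into it: every `‖T x‖` is unchanged. The remaining
point is that an extreme `T : ℓ_∞³ → ℓ_1³` has a vanishing coordinate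
(`exists_coord_eq_zero_of_isExtremeContraction`). The cube is the absolutely convex hull of four
vertices with sum zero, so contractions correspond to `3 × 4` matrices with zero row sums and
columns in the `ℓ_1³` ball. If no row is zero, a dimension count gives a two-sided perturbation,
except when the columns are very sparse; then one column is a signed unit vector and the
perturbation is explicit. -/

namespace UniformBPB

/-! ### Compactness and faces of the unit ball -/

section General

variable {X Y : Type*} [NormedAddCommGroup X] [NormedSpace ℝ X]
  [NormedAddCommGroup Y] [NormedSpace ℝ Y]

/-- In finite dimension, an operator close to `T` with the same norm attainment set is
automatically a uniform approximation. -/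
theorem isUniformBPBApprox_of_normAttainmentSet_eq [FiniteDimensional ℝ X] {ε : ℝ} (hε : 0 < ε)
    {T A : X →L[ℝ] Y} (hT : ‖T‖ = 1) (hA : ‖A‖ = 1)
    (hM : normAttainmentSet T = normAttainmentSet A) (hTA : ‖T - A‖ < ε) :
    IsUniformBPBApprox ε T A := by
  have : ProperSpace X := FiniteDimensional.proper ℝ X
  refine ⟨hT, hA, ?_⟩
  -- `K` is compact and misses `M_A = M_T`, so `‖T ·‖` stays away from `1` on it; the gap is `δ`.
  set K : Set X := Metric.sphere 0 1 ∩ ⋂ u ∈ normAttainmentSet A, {x | ε ≤ ‖u - x‖} with hK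
  have hKc : IsCompact K := (isCompact_sphere 0 1).inter_right <|
    isClosed_biInter fun u _ => isClosed_le continuous_const (by fun_prop)
  have key : ∃ δ : ℝ, 0 < δ ∧ ∀ x ∈ K, ‖T x‖ ≤ 1 - δ := by
    rcases K.eq_empty_or_nonempty with h | h
    · exact ⟨1, one_pos, by simp [h]⟩
    obtain ⟨z, hz, hmax⟩ := hKc.exists_isMaxOn h
      (f := fun x => ‖T x‖) (by fun_prop : Continuous fun x => ‖T x‖).continuousOn
    refine ⟨1 - ‖T z‖, ?_, fun x hx => by simpa using hmax hx⟩
    have hz1 : ‖z‖ = 1 := by simpa using hz.1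
    have hle : ‖T z‖ ≤ 1 := by simpa [hT, hz1] using T.le_opNorm z
    have hne : ‖T z‖ ≠ 1 := by
      intro h1
      have hzM : z ∈ normAttainmentSet A := hM ▸ ⟨hz1, by rw [h1, hT]⟩
      have := Set.mem_iInter₂.1 hz.2 z hzM
      simp only [sub_self, norm_zero, Set.mem_ofPred_eq] at this
      linarith
    exact sub_pos.2 (lt_of_le_of_ne hle hne)
  obtain ⟨δ, hδ, hδK⟩ := key
  refine ⟨δ, hδ, fun x hx hTx => ?_⟩
  by_contra hcon
  push Not at hcon
  refine absurd (hδK x ⟨by simpa using hx, Set.mem_iInter₂.2 fun u hu => ?_⟩) (not_le.2 hTx)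
  by_contra hlt
  exact absurd hTA (not_lt.2 (hcon u hu (not_le.1 hlt)))

/-- A norm one operator which is not an extreme contraction can be moved inside the minimal face
of the unit ball containing it without changing its norm attainment set. -/
theorem exists_nontrivial_approx_of_not_isExtremeContraction [FiniteDimensional ℝ X]
    {T : X →L[ℝ] Y} (hT : ‖T‖ = 1) (hne : ¬ IsExtremeContraction T) {ε : ℝ} (hε : 0 < ε) :
    ∃ A : X →L[ℝ] Y, IsNontrivialUniformBPBApprox ε T A ∧
      normAttainmentSet T = normAttainmentSet A := by
  have hTb : T ∈ Metric.closedBall (0 : X →L[ℝ] Y) 1 := by simp [hT]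
  rw [IsExtremeContraction, mem_extremePoints_iff_left] at hne
  push Not at hne
  obtain ⟨P, hP, Q, hQ, ⟨a, b, ha, hb, hab, hPQ⟩, hPT⟩ := hne hTb
  rw [mem_closedBall_zero_iff] at hP hQ
  have hd : 0 < ‖P - T‖ := norm_pos_iff.2 (sub_ne_zero.2 hPT)
  obtain ⟨t, ht0, ht1, htε⟩ : ∃ t : ℝ, 0 < t ∧ t < 1 ∧ t * ‖P - T‖ < ε := by
    refine ⟨min (1 / 2) (ε / (2 * ‖P - T‖)), by positivity,
      (min_le_left _ _).trans_lt (by norm_num), ?_⟩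
    calc _ ≤ ε / (2 * ‖P - T‖) * ‖P - T‖ := by gcongr; exact min_le_right _ _
      _ = ε / 2 := by field_simp
      _ < ε := by linarith
  -- `A` lies strictly between `T` and `P`, and `T` strictly between `A` and `Q`: attainment passes
  -- both ways.
  have hA : ∀ A, A = (1 - t) • T + t • P → (a + b * t) • T = a • A + (b * t) • Q := by
    rintro A rfl
    rw [← hPQ]
    obtain rfl : b = 1 - a := by linarith
    module
  obtain ⟨A, hAdef⟩ : ∃ A, A = (1 - t) • T + t • P := ⟨_, rfl⟩
  replace hA := hA A hAdef
  have hbt : 0 < b * t := by positivity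
  have hA1 : ‖A‖ ≤ 1 := by
    rw [hAdef]
    calc _ ≤ ‖(1 - t) • T‖ + ‖t • P‖ := norm_add_le _ _
      _ = (1 - t) * ‖T‖ + t * ‖P‖ := by
        rw [norm_smul, norm_smul, Real.norm_of_nonneg ht0.le, Real.norm_of_nonneg (by linarith)]
      _ ≤ 1 := by rw [hT]; nlinarith
  have hAn : ‖A‖ = 1 := by
    refine le_antisymm hA1 ?_
    have : ‖(a + b * t) • T‖ ≤ ‖a • A‖ + ‖(b * t) • Q‖ := hA ▸ norm_add_le _ _
    rw [norm_smul, norm_smul, norm_smul, Real.norm_of_nonneg ha.le, Real.norm_of_nonneg hbt.le,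
      Real.norm_of_nonneg (by positivity), hT] at this
    nlinarith
  have hM : normAttainmentSet T = normAttainmentSet A := by
    ext x
    refine and_congr_right fun hx => ?_
    have hle : ∀ S : X →L[ℝ] Y, ‖S‖ ≤ 1 → ‖S x‖ ≤ 1 := fun S hS =>
      (S.le_opNorm x).trans (by rw [hx, mul_one]; exact hS)
    have hTx := hle T hT.le
    have hAx := hle A hA1
    have hPx := hle P hP
    have hQx := hle Q hQ
    rw [hT, hAn]
    constructor
    · intro h
      refine le_antisymm hAx ?_
      have h1 : (a + b * t) • T x = a • A x + (b * t) • Q x := by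
        simpa using congrArg (fun S : X →L[ℝ] Y => S x) hA
      have : ‖(a + b * t) • T x‖ ≤ ‖a • A x‖ + ‖(b * t) • Q x‖ := h1 ▸ norm_add_le _ _
      rw [norm_smul, norm_smul, norm_smul, Real.norm_of_nonneg ha.le, Real.norm_of_nonneg hbt.le,
        Real.norm_of_nonneg (by positivity), h] at this
      nlinarith
    · intro h
      refine le_antisymm hTx ?_
      have h1 : A x = (1 - t) • T x + t • P x := by simp [hAdef]
      have : ‖A x‖ ≤ ‖(1 - t) • T x‖ + ‖t • P x‖ := h1 ▸ norm_add_le _ _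
      rw [norm_smul, norm_smul, Real.norm_of_nonneg ht0.le, Real.norm_of_nonneg (by linarith),
        h] at this
      nlinarith
  have hTA : T - A = -(t • (P - T)) := by rw [hAdef]; module
  refine ⟨A, ⟨isUniformBPBApprox_of_normAttainmentSet_eq hε hT hAn hM ?_, ?_⟩, hM⟩
  · rw [hTA, norm_neg, norm_smul, Real.norm_of_nonneg ht0.le]
    exact htε
  · intro h
    rw [h, sub_self, eq_comm, neg_eq_zero, smul_eq_zero] at hTA
    exact hTA.elim ht0.ne' (sub_ne_zero.2 hPT)

/-- Two operators with the same pointwise norms have the same operator norm. -/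
theorem norm_eq_of_forall_norm_eq {T A : X →L[ℝ] Y} (h : ∀ x, ‖A x‖ = ‖T x‖) : ‖A‖ = ‖T‖ :=
  le_antisymm (A.opNorm_le_bound (norm_nonneg _) fun x => h x ▸ T.le_opNorm x)
    (T.opNorm_le_bound (norm_nonneg _) fun x => h x ▸ A.le_opNorm x)

end General

/-- If one coordinate of an operator into `ℓ_1ⁿ` vanishes, a fraction of another coordinate can be
moved there without changing any of the norms `‖T x‖`. -/
theorem exists_nontrivial_approx_of_coord_eq_zero {X : Type*} [NormedAddCommGroup X]
    [NormedSpace ℝ X] [FiniteDimensional ℝ X] {n : ℕ} {T : X →L[ℝ] ell 1 n} (hT : ‖T‖ = 1)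
    {k : Fin n} (hk : ∀ x, T x k = 0) {ε : ℝ} (hε : 0 < ε) :
    ∃ A : X →L[ℝ] ell 1 n, IsNontrivialUniformBPBApprox ε T A ∧
      normAttainmentSet T = normAttainmentSet A := by
  obtain ⟨z, j, hj⟩ : ∃ z j, T z j ≠ 0 := by
    by_contra! h
    have : T = 0 := by ext x i; simpa using h x i
    simp [this] at hT
  have hjk : j ≠ k := by rintro rfl; exact hj (hk z)
  obtain ⟨E, hE⟩ : ∃ E : X →L[ℝ] ell 1 n, ∀ x i,
      E x i = (if i = k then T x j else 0) - (if i = j then T x j else 0) := by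
    refine ⟨LinearMap.toContinuousLinearMap
      { toFun := fun x => WithLp.toLp 1 fun i =>
          (if i = k then T x j else 0) - (if i = j then T x j else 0)
        map_add' := fun x y => ?_
        map_smul' := fun c x => ?_ }, fun x i => ?_⟩
    · ext i; simp; split_ifs <;> ring
    · ext i; simp; split_ifs <;> ring
    · simp
  have hE0 : 0 < ‖E‖ := by
    refine norm_pos_iff.2 fun h => hj ?_
    have := hE z k
    simpa [h, hjk.symm] using this.symm
  obtain ⟨t, ht0, ht1, htε⟩ : ∃ t : ℝ, 0 < t ∧ t < 1 ∧ t * ‖E‖ < ε := by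
    refine ⟨min (1 / 2) (ε / (2 * ‖E‖)), by positivity,
      (min_le_left _ _).trans_lt (by norm_num), ?_⟩
    calc _ ≤ ε / (2 * ‖E‖) * ‖E‖ := by gcongr; exact min_le_right _ _
      _ = ε / 2 := by field_simp
      _ < ε := by linarith
  have hnorm : ∀ x, ‖(T + t • E) x‖ = ‖T x‖ := by
    intro x
    rw [PiLp.norm_eq_of_L1, PiLp.norm_eq_of_L1, ← sub_eq_zero, ← Finset.sum_sub_distrib]
    have hterm : ∀ i, ‖(T + t • E) x i‖ - ‖T x i‖
        = (if i = k then t * ‖T x j‖ else 0) - (if i = j then t * ‖T x j‖ else 0) := by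
      intro i
      have hi : (T + t • E) x i = T x i + t * E x i := by simp
      rw [hi, hE]
      by_cases h1 : i = k
      · subst h1
        simp [hk, hjk.symm, abs_of_pos ht0]
      · by_cases h2 : i = j
        · subst h2
          have : T x i + t * (0 - T x i) = (1 - t) * T x i := by ring
          simp only [if_neg h1, if_true, this, norm_mul, Real.norm_of_nonneg (sub_pos.2 ht1).le]
          ring
        · simp [h1, h2]
    rw [Finset.sum_congr rfl fun i _ => hterm i]
    simp
  have hAn := norm_eq_of_forall_norm_eq hnorm
  have hM : normAttainmentSet T = normAttainmentSet (T + t • E) := by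
    ext x; simp only [normAttainmentSet, Set.mem_ofPred_eq, hnorm, hAn]
  refine ⟨T + t • E, ⟨isUniformBPBApprox_of_normAttainmentSet_eq hε hT (hAn.trans hT) hM ?_, ?_⟩,
    hM⟩
  · rw [sub_add_cancel_left, norm_neg, norm_smul, Real.norm_of_nonneg ht0.le]
    exact htε
  · intro h
    rw [add_eq_left, smul_eq_zero] at h
    exact h.elim ht0.ne' (norm_pos_iff.1 hE0)

/-! ### Counting first-order constraints -/

/-- A nonzero direction in which a `3 × 4` matrix with columns in the unit ball of `ℓ_1³` can be
moved both ways to first order: the row sums do not change, and in each column of norm one the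
zero entries and the norm are kept. -/
def IsPerturbable (Y : Fin 3 → Fin 4 → ℝ) : Prop :=
  ∃ D : Fin 3 → Fin 4 → ℝ, D ≠ 0 ∧ (∀ i, ∑ j, D i j = 0) ∧
    ∀ j, ∑ i, |Y i j| = 1 →
      (∀ i, Y i j = 0 → D i j = 0) ∧ ∑ i, Real.sign (Y i j) * D i j = 0

theorem IsPerturbable.of_perm {Y : Fin 3 → Fin 4 → ℝ} (σ : Equiv.Perm (Fin 3))
    (τ : Equiv.Perm (Fin 4)) (h : IsPerturbable fun i j => Y (σ i) (τ j)) : IsPerturbable Y := by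
  obtain ⟨D, hD0, hDrow, hDcol⟩ := h
  refine ⟨fun i j => D (σ.symm i) (τ.symm j), fun h => hD0 ?_, fun i => ?_, fun j hj => ?_⟩
  · ext i j
    simpa using congrFun (congrFun h (σ i)) (τ j)
  · rw [Equiv.sum_comp τ.symm (D (σ.symm i))]
    exact hDrow _
  · have := hDcol (τ.symm j) (by
      rw [← hj, ← Equiv.sum_comp σ fun i => |Y i j|]
      simp)
    refine ⟨fun i hi => this.1 _ (by simpa using hi), ?_⟩
    rw [← this.2, ← Equiv.sum_comp σ]
    simp

theorem IsPerturbable.of_neg {Y : Fin 3 → Fin 4 → ℝ} (h : IsPerturbable fun i j => -Y i j) :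
    IsPerturbable Y := by
  obtain ⟨D, hD0, hDrow, hDcol⟩ := h
  refine ⟨D, hD0, hDrow, fun j hj => ?_⟩
  have := hDcol j (by simpa using hj)
  refine ⟨fun i hi => this.1 i (by simpa using hi), ?_⟩
  simpa [Real.sign_neg] using this.2

open Classical in
/-- The number of first order constraints coming from a column, see `IsPerturbable`. -/
noncomputable def constraintCount (y : Fin 3 → ℝ) : ℕ :=
  if ∑ i, |y i| = 1 then 1 + ∑ i, (if y i = 0 then 1 else 0) else 0

/-- There are 12 unknown entries and 3 row equations, so fewer than 9 column constraints leave a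
nonzero kernel. -/
theorem isPerturbable_of_sum_constraintCount_lt {Y : Fin 3 → Fin 4 → ℝ}
    (h : ∑ j, constraintCount (fun i => Y i j) < 9) : IsPerturbable Y := by
  classical
  let L : (Fin 3 → Fin 4 → ℝ) →ₗ[ℝ] (Fin 3 → ℝ) × ({j // ∑ i, |Y i j| = 1} → ℝ) ×
      ({p : Fin 3 × Fin 4 // ∑ i, |Y i p.2| = 1 ∧ Y p.1 p.2 = 0} → ℝ) :=
    { toFun := fun D => (fun i => ∑ j, D i j, fun j => ∑ i, Real.sign (Y i j) * D i j,
        fun p => D p.1.1 p.1.2)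
      map_add' := fun D E => by
        ext <;> simp [Finset.sum_add_distrib, mul_add]
      map_smul' := fun c D => by
        ext <;> simp [Finset.mul_sum, mul_left_comm] }
  have hker : LinearMap.ker L ≠ ⊥ := by
    apply LinearMap.ker_ne_bot_of_finrank_lt
    simp only [Module.finrank_prod, Module.finrank_fintype_fun_eq_card, Module.finrank_pi_fintype,
      Fintype.card_subtype, Fintype.card_fin, Finset.card_filter, Fintype.sum_prod_type_right,
      Finset.sum_const, Finset.card_univ, smul_eq_mul]
    have : ∑ j, constraintCount (fun i => Y i j) = (∑ j, if ∑ i, |Y i j| = 1 then 1 else 0) +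
        ∑ j, ∑ i, if ∑ i, |Y i j| = 1 ∧ Y i j = 0 then 1 else 0 := by
      rw [← Finset.sum_add_distrib]
      refine Finset.sum_congr rfl fun j _ => ?_
      unfold constraintCount
      by_cases hj : ∑ i, |Y i j| = 1 <;> simp [hj]
    omega
  obtain ⟨D, hD, hD0⟩ := (Submodule.ne_bot_iff _).1 hker
  rw [LinearMap.mem_ker, Prod.ext_iff, Prod.ext_iff] at hD
  refine ⟨D, hD0, fun i => congrFun hD.1 i, fun j hj => ⟨fun i hi => ?_, ?_⟩⟩
  · exact congrFun hD.2.2 ⟨(i, j), hj, hi⟩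
  · exact congrFun hD.2.1 ⟨j, hj⟩

theorem constraintCount_le_three (y : Fin 3 → ℝ) : constraintCount y ≤ 3 := by
  unfold constraintCount
  split_ifs with h
  · by_contra! hlt
    simp only [Fin.sum_univ_three] at h hlt
    have h0 : y 0 = 0 := by by_contra h0; simp only [h0, if_false] at hlt; split_ifs at hlt <;> omega
    have h1 : y 1 = 0 := by by_contra h1; simp only [h1, if_false] at hlt; split_ifs at hlt <;> omega
    have h2 : y 2 = 0 := by by_contra h2; simp only [h2, if_false] at hlt; split_ifs at hlt <;> omega
    simp [h0, h1, h2] at h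
  · omega

/-- A column subject to three constraints has exactly one nonzero entry. -/
theorem exists_of_constraintCount_eq_three {y : Fin 3 → ℝ} (h : constraintCount y = 3) :
    ∃ i, |y i| = 1 ∧ ∀ k, k ≠ i → y k = 0 := by
  unfold constraintCount at h
  split_ifs at h with hy
  simp only [Fin.sum_univ_three] at h hy
  by_cases h0 : y 0 = 0 <;> by_cases h1 : y 1 = 0 <;> by_cases h2 : y 2 = 0 <;>
    simp only [h0, h1, h2, if_true, if_false] at h <;> try omega
  · exact ⟨2, by simpa [h0, h1] using hy, by intro k hk; fin_cases k <;> simp_all⟩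
  · exact ⟨1, by simpa [h0, h2] using hy, by intro k hk; fin_cases k <;> simp_all⟩
  · exact ⟨0, by simpa [h1, h2] using hy, by intro k hk; fin_cases k <;> simp_all⟩

/-! ### The exceptional sparse matrices -/

theorem neg_of_overlapping_pairs {p q a b c : ℝ} (hp : p ≠ 0) (hq : q ≠ 0) (h0 : |p| + |a| = 1)
    (h1 : |p| + |q| + |b| = 1) (h2 : |q| + |c| = 1) (hs : a + b + c = -1)
    (hz : a = 0 ∨ b = 0 ∨ c = 0) : a < 0 ∧ c < 0 := by
  have hp' := abs_pos.2 hp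
  have hq' := abs_pos.2 hq
  have hb' := abs_nonneg b
  have ha := neg_abs_le a
  have hc := neg_abs_le c
  rcases hz with rfl | rfl | rfl
  · rw [abs_zero] at h0; linarith
  · rw [abs_zero] at h1; constructor <;> linarith
  · rw [abs_zero] at h2; linarith

/-- The combinatorial heart of the exceptional case: two zero-sum vectors `u, w` and a vector `c`
of sum `-1` filling up the columns, with many zeros. -/
theorem filled_columns {u0 u1 u2 w0 w1 w2 c0 c1 c2 : ℝ} (hu : u0 + u1 + u2 = 0)
    (hw : w0 + w1 + w2 = 0) (hc : c0 + c1 + c2 = -1) (hu0 : ¬ (u0 = 0 ∧ u1 = 0 ∧ u2 = 0))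
    (hw0 : ¬ (w0 = 0 ∧ w1 = 0 ∧ w2 = 0)) (h0 : |u0| + |w0| + |c0| = 1)
    (h1 : |u1| + |w1| + |c1| = 1) (h2 : |u2| + |w2| + |c2| = 1) (z : ℝ → ℕ)
    (z0 : z 0 = 1) (z1 : ∀ x, x ≠ 0 → z x = 0)
    (hz : 3 ≤ (z u0 + z w0 + z c0) + (z u1 + z w1 + z c1) + (z u2 + z w2 + z c2)) :
    ((|w0| + |w1| + |w2|) * |u0| = (|u0| + |u1| + |u2|) * |w0| ∨ c0 < 0) ∧
    ((|w0| + |w1| + |w2|) * |u1| = (|u0| + |u1| + |u2|) * |w1| ∨ c1 < 0) ∧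
    ((|w0| + |w1| + |w2|) * |u2| = (|u0| + |u1| + |u2|) * |w2| ∨ c2 < 0) := by
  have split : ∀ a b c : ℝ, a + b + c = 0 → ¬ (a = 0 ∧ b = 0 ∧ c = 0) →
      (a = 0 ∧ b ≠ 0 ∧ c = -b) ∨ (b = 0 ∧ c ≠ 0 ∧ a = -c) ∨ (c = 0 ∧ a ≠ 0 ∧ b = -a) ∨
        (a ≠ 0 ∧ b ≠ 0 ∧ c ≠ 0) := by
    intro a b c h hn
    by_cases ha : a = 0 <;> by_cases hb : b = 0 <;> by_cases hc : c = 0 <;> grind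
  have csplit : ∀ x : ℝ, (x = 0 ∧ z x = 1) ∨ (x ≠ 0 ∧ z x = 0) := by
    intro x
    by_cases hx : x = 0
    · exact .inl ⟨hx, hx ▸ z0⟩
    · exact .inr ⟨hx, z1 x hx⟩
  have anon := fun x : ℝ => abs_nonneg x
  have one_of : ∀ {n : ℕ}, 3 ≤ n → n = 2 + (z c0 + z c1 + z c2) → c0 = 0 ∨ c1 = 0 ∨ c2 = 0 := by
    intro n h3 hn
    rcases csplit c0 with h | h <;> rcases csplit c1 with h' | h' <;>
      rcases csplit c2 with h'' | h'' <;> first | (exfalso; omega) | tauto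
  have two_of : ∀ {n : ℕ}, 3 ≤ n → n ≤ 1 + (z c0 + z c1 + z c2) →
      (c1 = 0 ∧ c2 = 0 ∧ |c0| = 1) ∨ (c0 = 0 ∧ c2 = 0 ∧ |c1| = 1) ∨
        (c0 = 0 ∧ c1 = 0 ∧ |c2| = 1) := by
    intro n h3 hn
    rcases csplit c0 with h | h <;> rcases csplit c1 with h' | h' <;>
      rcases csplit c2 with h'' | h'' <;> first
      | (exfalso; omega)
      | (exfalso; linarith [h.1, h'.1, h''.1])
      | (refine .inl ⟨h'.1, h''.1, ?_⟩
         rw [show c0 = -1 by linarith [h'.1, h''.1]]; simp)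
      | (refine .inr (.inl ⟨h.1, h''.1, ?_⟩)
         rw [show c1 = -1 by linarith [h.1, h''.1]]; simp)
      | (refine .inr (.inr ⟨h.1, h'.1, ?_⟩)
         rw [show c2 = -1 by linarith [h.1, h'.1]]; simp)
  -- A unit entry of `c` fills its column, leaving no room for `u` or `w`. This rules out full
  -- support for either: `c` would then have two zeros.
  have not_unit : ¬ ((u0 ≠ 0 ∨ w0 ≠ 0) ∧ (u1 ≠ 0 ∨ w1 ≠ 0) ∧ (u2 ≠ 0 ∨ w2 ≠ 0) ∧
      ((c1 = 0 ∧ c2 = 0 ∧ |c0| = 1) ∨ (c0 = 0 ∧ c2 = 0 ∧ |c1| = 1) ∨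
        (c0 = 0 ∧ c1 = 0 ∧ |c2| = 1))) := by
    have pos : ∀ a b : ℝ, a ≠ 0 ∨ b ≠ 0 → 0 < |a| + |b| := by
      rintro a b (h | h)
      · have := abs_pos.2 h; have := anon b; linarith
      · have := abs_pos.2 h; have := anon a; linarith
    rintro ⟨ha, hb, hc, h⟩
    have := pos _ _ ha
    have := pos _ _ hb
    have := pos _ _ hc
    rcases h with h | h | h <;> linarith [h.2.2]
  rcases split _ _ _ hu hu0 with ⟨rfl, hp, rfl⟩ | ⟨rfl, hp, rfl⟩ | ⟨rfl, hp, rfl⟩ | ⟨hp, hp', hp''⟩ <;>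
  rcases split _ _ _ hw hw0 with ⟨rfl, hq, rfl⟩ | ⟨rfl, hq, rfl⟩ | ⟨rfl, hq, rfl⟩ | ⟨hq, hq', hq''⟩
  case inr.inr.inr.inr.inr.inr =>
    refine absurd ⟨.inl hp, .inl hp', .inl hp'', two_of hz ?_⟩ not_unit
    simp only [z1 _ hp, z1 _ hp', z1 _ hp'', z1 _ hq, z1 _ hq', z1 _ hq'']; omega
  all_goals
    first
    | (refine absurd ⟨.inl hp, .inl hp', .inl hp'', two_of hz ?_⟩ not_unit
       simp only [z0, z1 _ hp, z1 _ hp', z1 _ hp'', z1 _ hq, z1 _ (neg_ne_zero.2 hq)]; omega)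
    | (refine absurd ⟨.inr hq, .inr hq', .inr hq'', two_of hz ?_⟩ not_unit
       simp only [z0, z1 _ hq, z1 _ hq', z1 _ hq'', z1 _ hp, z1 _ (neg_ne_zero.2 hp)]; omega)
    | skip
  -- Now `u = ±(p, -p)` and `w = ±(q, -q)` on two-element supports. On equal supports they are
  -- proportional in absolute value; otherwise the supports share one column, where equality holds,
  -- and `c` is negative in the other two.
  all_goals
    have hzc := one_of hz (by
      simp only [z0, z1 _ hp, z1 _ (neg_ne_zero.2 hp), z1 _ hq, z1 _ (neg_ne_zero.2 hq)]; omega)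
    clear not_unit two_of one_of csplit split hz
    simp only [abs_neg, abs_zero, add_zero, zero_add] at h0 h1 h2 ⊢
  all_goals
    first
    | (refine ⟨.inl ?_, .inl ?_, .inl ?_⟩ <;> ring1)
    | skip
  · obtain ⟨h, h'⟩ := neg_of_overlapping_pairs (b := c2) hp hq h1 h2 h0 (by linarith) (by tauto)
    exact ⟨.inr h', .inr h, .inl (by ring)⟩
  · obtain ⟨h, h'⟩ := neg_of_overlapping_pairs (b := c1) hp hq h2 h1 h0 (by linarith) (by tauto)
    exact ⟨.inr h', .inl (by ring), .inr h⟩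
  · obtain ⟨h, h'⟩ := neg_of_overlapping_pairs (b := c2) hp hq h0 h2 h1 (by linarith) (by tauto)
    exact ⟨.inr h, .inr h', .inl (by ring)⟩
  · obtain ⟨h, h'⟩ := neg_of_overlapping_pairs (b := c0) hp hq h2 h0 h1 (by linarith) (by tauto)
    exact ⟨.inl (by ring), .inr h', .inr h⟩
  · obtain ⟨h, h'⟩ := neg_of_overlapping_pairs (b := c1) hp hq h0 h1 h2 (by linarith) (by tauto)
    exact ⟨.inr h, .inl (by ring), .inr h'⟩
  · obtain ⟨h, h'⟩ := neg_of_overlapping_pairs (b := c0) hp hq h1 h0 h2 (by linarith) (by tauto)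
    exact ⟨.inl (by ring), .inr h, .inr h'⟩

theorem eq_one_or_neg_one_of_unit_column {a b c : ℝ}
    (h : ∃ i, |![a, b, c] i| = 1 ∧ ∀ k, k ≠ i → ![a, b, c] k = 0) :
    ((a = 1 ∨ a = -1) ∧ b = 0 ∧ c = 0) ∨ (a = 0 ∧ (b = 1 ∨ b = -1) ∧ c = 0) ∨
      (a = 0 ∧ b = 0 ∧ (c = 1 ∨ c = -1)) := by
  obtain ⟨i, hi, hk⟩ := h
  rw [abs_eq zero_le_one] at hi
  match i, hi, hk with
  | 0, hi, hk => exact .inl ⟨hi, hk 1 (by decide), hk 2 (by decide)⟩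
  | 1, hi, hk => exact .inr (.inl ⟨hk 0 (by decide), hi, hk 2 (by decide)⟩)
  | 2, hi, hk => exact .inr (.inr ⟨hk 0 (by decide), hk 1 (by decide), hi⟩)

/-- A zero-sum family of three rows cannot have two full unit columns and a short one. -/
theorem false_of_two_unit_columns {u w c : Fin 3 → ℝ} (hu : ∑ j, u j = 0) (hw : ∑ j, w j = 0)
    (hc : ∑ j, c j = -1) {x y t : Fin 3} (hxy : x ≠ y) (hxt : x ≠ t)
    (hyt : y ≠ t) (ht : |u t| + |w t| + |c t| < 1)
    (hx : ∃ i, |![u x, w x, c x] i| = 1 ∧ ∀ k, k ≠ i → ![u x, w x, c x] k = 0)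
    (hy : ∃ i, |![u y, w y, c y] i| = 1 ∧ ∀ k, k ≠ i → ![u y, w y, c y] k = 0) : False := by
  have huniv : (Finset.univ : Finset (Fin 3)) = {x, y, t} :=
    (by decide : ∀ x y t : Fin 3, x ≠ y → x ≠ t → y ≠ t → Finset.univ = {x, y, t}) x y t hxy hxt hyt
  have hsum : ∀ f : Fin 3 → ℝ, ∑ j, f j = f x + f y + f t := by
    intro f
    rw [huniv, Finset.sum_insert (by simp [hxy, hxt]), Finset.sum_pair hyt, add_assoc]
  rw [hsum] at hu hw hc
  have := abs_nonneg (u t)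
  have := abs_nonneg (w t)
  have := abs_nonneg (c t)
  have hut := abs_lt.1 (show |u t| < 1 by linarith)
  have hwt := abs_lt.1 (show |w t| < 1 by linarith)
  have hct := abs_lt.1 (show |c t| < 1 by linarith)
  -- Parity: all entries sum to `-1` and the unit columns contribute an even number, so column `t`
  -- has an odd sum, of absolute value below `1`.
  rcases eq_one_or_neg_one_of_unit_column hx with ⟨h | h, h', h''⟩ | ⟨h', h | h, h''⟩ | ⟨h', h'', h | h⟩ <;>
  rcases eq_one_or_neg_one_of_unit_column hy with ⟨k | k, k', k''⟩ | ⟨k', k | k, k''⟩ | ⟨k', k'', k | k⟩ <;>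
  linarith

theorem isPerturbable_of_unit_last_column {Y : Fin 3 → Fin 4 → ℝ} (hrow : ∀ i, ∑ j, Y i j = 0)
    (hcol : ∀ j, ∑ i, |Y i j| ≤ 1) (hne : ∀ i, Y i ≠ 0) (h0 : Y 0 3 = 0) (h1 : Y 1 3 = 0)
    (h2 : Y 2 3 = 1) (hcount : 9 ≤ ∑ j, constraintCount (fun i => Y i j)) :
    IsPerturbable Y := by
  classical
  have hvec : ∀ j, (fun i => Y i j) = ![Y 0 j, Y 1 j, Y 2 j] := by
    intro j; ext i; fin_cases i <;> rfl
  have hc3 := fun j => constraintCount_le_three (fun i => Y i j)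
  have hu : ∑ j : Fin 3, Y 0 j.castSucc = 0 := by
    have := hrow 0; rw [Fin.sum_univ_castSucc] at this
    simpa [show Fin.last 3 = 3 from rfl, h0] using this
  have hw : ∑ j : Fin 3, Y 1 j.castSucc = 0 := by
    have := hrow 1; rw [Fin.sum_univ_castSucc] at this
    simpa [show Fin.last 3 = 3 from rfl, h1] using this
  have hc : ∑ j : Fin 3, Y 2 j.castSucc = -1 := by
    have := hrow 2; rw [Fin.sum_univ_castSucc, show Fin.last 3 = 3 from rfl, h2] at this
    linarith
  -- A slack column contributes no constraint, so reaching 9 would force the three others to be unit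
  -- columns.
  have htight : ∀ j : Fin 3, ∑ i, |Y i j.castSucc| = 1 := by
    intro t
    by_contra ht
    have hlt := lt_of_le_of_ne (hcol t.castSucc) ht
    have hct : constraintCount (fun i => Y i t.castSucc) = 0 := if_neg ht
    have hother : ∀ x, x ≠ t → constraintCount (fun i => Y i x.castSucc) = 3 := by
      intro x hx
      have a0 := hc3 0
      have a1 := hc3 1
      have a2 := hc3 2
      have a3 := hc3 3
      simp only [Fin.sum_univ_four] at hcount
      fin_cases t <;> fin_cases x <;> simp at hx hct ⊢ <;> omega
    obtain ⟨x, y, hxy, hxt, hyt⟩ :=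
      (by decide : ∀ t : Fin 3, ∃ x y : Fin 3, x ≠ y ∧ x ≠ t ∧ y ≠ t) t
    have hx := exists_of_constraintCount_eq_three (hvec x.castSucc ▸ hother x hxt)
    have hy := exists_of_constraintCount_eq_three (hvec y.castSucc ▸ hother y hyt)
    exact false_of_two_unit_columns hu hw hc hxy hxt hyt
      (by simpa [Fin.sum_univ_three] using hlt) hx hy
  have hz : 3 ≤ ∑ j : Fin 3, ∑ i, if Y i j.castSucc = 0 then 1 else 0 := by
    have h3 := hc3 (Fin.last 3)
    rw [Fin.sum_univ_castSucc] at hcount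
    have : ∀ j : Fin 3, constraintCount (fun i => Y i j.castSucc)
        = 1 + ∑ i, if Y i j.castSucc = 0 then 1 else 0 := fun j => if_pos (htight j)
    simp only [this, Finset.sum_add_distrib, Finset.sum_const, Finset.card_univ,
      Fintype.card_fin, smul_eq_mul] at hcount ⊢
    omega
  have key : ∀ j : Fin 3, (∑ k, |Y 1 k|) * |Y 0 j.castSucc| = (∑ k, |Y 0 k|) * |Y 1 j.castSucc| ∨
      Y 2 j.castSucc < 0 := by
    have hnz : ∀ i, Y i 3 = 0 →
        ¬ (Y i (Fin.castSucc 0) = 0 ∧ Y i (Fin.castSucc 1) = 0 ∧ Y i (Fin.castSucc 2) = 0) := by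
      rintro i hi ⟨g0, g1, g2⟩
      refine hne i (funext fun j => ?_)
      fin_cases j
      exacts [g0, g1, g2, hi]
    simp only [Fin.sum_univ_three] at hu hw hc htight hz
    have := filled_columns hu hw hc (hnz 0 h0) (hnz 1 h1) (htight 0) (htight 1) (htight 2)
      (fun x => if x = 0 then 1 else 0) (if_pos rfl) (fun x hx => if_neg hx) hz
    intro j
    simp only [Fin.sum_univ_castSucc (n := 3), Fin.sum_univ_three, show Fin.last 3 = 3 from rfl,
      h0, h1, abs_zero, add_zero]
    fin_cases j
    exacts [this.1, this.2.1, this.2.2]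
  have hW : 0 < ∑ k, |Y 1 k| := by
    obtain ⟨j, hj⟩ := Function.ne_iff.1 (hne 1)
    exact Finset.sum_pos' (fun _ _ => abs_nonneg _) ⟨j, Finset.mem_univ _, abs_pos.2 hj⟩
  set W := ∑ k, |Y 1 k| with hWdef
  set U := ∑ k, |Y 0 k| with hUdef
  -- Rescale the first two rows oppositely and let the third compensate. Its sum is `W * U - U * W =
  -- 0`; a column norm is kept to first order where the third entry of `Y` is negative or the
  -- compensation vanishes, as `key` provides.
  refine ⟨![fun j => W * Y 0 j, fun j => -(U * Y 1 j), fun j => W * |Y 0 j| - U * |Y 1 j|],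
    fun hD => ?_, fun i => ?_, fun j _ => ?_⟩
  · obtain ⟨j, hj⟩ := Function.ne_iff.1 (hne 0)
    have := congrFun (congrFun hD 0) j
    exact (mul_ne_zero hW.ne' hj) this
  · fin_cases i
    · simp [← Finset.mul_sum, hrow]
    · simp [← Finset.mul_sum, hrow]
    · change ∑ j, (W * |Y 0 j| - U * |Y 1 j|) = 0
      rw [Finset.sum_sub_distrib, ← Finset.mul_sum, ← Finset.mul_sum, ← hWdef, ← hUdef]
      ring
  · have hj : W * |Y 0 j| = U * |Y 1 j| ∨ Y 2 j < 0 := by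
      induction j using Fin.lastCases with
      | last => left; rw [show Fin.last 3 = 3 from rfl, h0, h1]; simp
      | cast j => exact key j
    constructor
    · intro i hi
      fin_cases i
      · simp at hi; simp [hi]
      · simp at hi; simp [hi]
      · rcases hj with hj | hj
        · simp [hj]
        · simp at hi; linarith
    · have hs : ∀ x : ℝ, Real.sign x * x = |x| := by
        intro x
        rcases lt_trichotomy x 0 with h | rfl | h
        · rw [Real.sign_of_neg h, abs_of_neg h]; ring
        · simp
        · rw [Real.sign_of_pos h, abs_of_pos h]; ring
      simp only [Fin.sum_univ_three]
      have e0 := hs (Y 0 j)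
      have e1 := hs (Y 1 j)
      simp only [Matrix.cons_val_zero, Matrix.cons_val_one, Matrix.cons_val]
      rcases hj with hj | hj
      · rw [hj]; linear_combination W * e0 - U * e1 + hj
      · rw [Real.sign_of_neg hj]; linear_combination W * e0 - U * e1

/-- A `3 × 4` matrix with zero row sums, nonzero rows, and columns in the unit ball of `ℓ_1³`
is perturbable. -/
theorem isPerturbable_of_rows_ne_zero {Y : Fin 3 → Fin 4 → ℝ} (hrow : ∀ i, ∑ j, Y i j = 0)
    (hcol : ∀ j, ∑ i, |Y i j| ≤ 1) (hne : ∀ i, Y i ≠ 0) : IsPerturbable Y := by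
  rcases lt_or_ge (∑ j, constraintCount (fun i => Y i j)) 9 with h | hcount
  · exact isPerturbable_of_sum_constraintCount_lt h
  -- Pigeonhole: four columns with at most 2 constraints each give only 8.
  obtain ⟨t, ht⟩ : ∃ t, constraintCount (fun i => Y i t) = 3 := by
    by_contra! hlt
    have : ∑ j, constraintCount (fun i => Y i j) ≤ ∑ _j : Fin 4, 2 :=
      Finset.sum_le_sum fun j _ => by
        have := constraintCount_le_three (fun i => Y i j)
        have := hlt j
        omega
    simp at this
    omega
  obtain ⟨i, hi, hk⟩ := exists_of_constraintCount_eq_three ht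
  have aux : ∀ Z : Fin 3 → Fin 4 → ℝ, (∀ i, ∑ j, Z i j = 0) → (∀ j, ∑ i, |Z i j| ≤ 1) →
      (∀ i, Z i ≠ 0) → 9 ≤ ∑ j, constraintCount (fun i => Z i j) → Z i t = 1 →
      (∀ k, k ≠ i → Z k t = 0) → IsPerturbable Z := by
    intro Z zrow zcol zne zcount zi zk
    set σ := Equiv.swap 2 i
    set τ := Equiv.swap 3 t
    have hσ : ∀ k, k ≠ 2 → σ k ≠ i := fun k hk h => hk <| σ.injective (by simp [h, σ])
    refine IsPerturbable.of_perm σ τ (isPerturbable_of_unit_last_column (fun k => ?_) (fun j => ?_)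
      (fun k hk => zne (σ k) ?_) ?_ ?_ ?_ ?_)
    · rw [Equiv.sum_comp τ (Z (σ k))]; exact zrow _
    · rw [Equiv.sum_comp σ fun k => |Z k (τ j)|]; exact zcol _
    · ext j; simpa using congrFun hk (τ.symm j)
    · simpa [τ] using zk _ (hσ 0 (by decide))
    · simpa [τ] using zk _ (hσ 1 (by decide))
    · simpa [τ, σ] using zi
    · have : ∀ j, constraintCount (fun k => Z (σ k) (τ j)) = constraintCount (fun k => Z k (τ j)) := by
        intro j
        unfold constraintCount
        rw [Equiv.sum_comp σ fun k => |Z k (τ j)|,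
          Equiv.sum_comp σ fun k => if Z k (τ j) = 0 then 1 else 0]
      simp only [this]
      rwa [Equiv.sum_comp τ fun j => constraintCount (fun k => Z k j)]
  rcases (abs_eq zero_le_one).1 hi with h1 | h1
  · exact aux Y hrow hcol hne hcount h1 hk
  · refine IsPerturbable.of_neg (aux _ (fun k => ?_) (fun j => ?_) (fun k hk => ?_) ?_ ?_ ?_)
    · simp [hrow]
    · simpa using hcol j
    · exact hne k (by ext j; simpa using congrFun hk j)
    · simpa [constraintCount] using hcount
    · simp [h1]
    · intro k hk'; simpa using hk k hk'

/-! ### From first-order to actual perturbations -/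

theorem eventually_abs_add_mul_eq {y d : ℝ} (h : y = 0 → d = 0) :
    ∀ᶠ t in nhds (0 : ℝ), |y + t * d| = |y| + t * (Real.sign y * d) := by
  have hcont : Filter.Tendsto (fun t : ℝ => y + t * d) (nhds 0) (nhds y) := by
    have : Continuous fun t : ℝ => y + t * d := by fun_prop
    simpa using this.tendsto 0
  rcases lt_trichotomy y 0 with hy | hy | hy
  · filter_upwards [hcont.eventually_lt_const hy] with t ht
    rw [abs_of_neg ht, abs_of_neg hy, Real.sign_of_neg hy]; ring
  · simp [hy, h hy]
  · filter_upwards [hcont.eventually_const_lt hy] with t ht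
    rw [abs_of_pos ht, abs_of_pos hy, Real.sign_of_pos hy]; ring

/-- For small steps of either sign, tight columns keep norm exactly `1`, because the absolute values
are locally affine, and slack columns stay in the ball by continuity. -/
theorem IsPerturbable.exists_direction {Y : Fin 3 → Fin 4 → ℝ} (h : IsPerturbable Y)
    (hcol : ∀ j, ∑ i, |Y i j| ≤ 1) :
    ∃ D : Fin 3 → Fin 4 → ℝ, D ≠ 0 ∧ (∀ i, ∑ j, D i j = 0) ∧
      ∀ j, ∑ i, |Y i j + D i j| ≤ 1 ∧ ∑ i, |Y i j - D i j| ≤ 1 := by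
  obtain ⟨D, hD0, hDrow, hD⟩ := h
  have hev : ∀ᶠ t in nhds (0 : ℝ), ∀ j, ∑ i, |Y i j + t * D i j| ≤ 1 := by
    refine Filter.eventually_all.2 fun j => ?_
    rcases (hcol j).eq_or_lt with hj | hj
    · filter_upwards [Filter.eventually_all.2 fun i => eventually_abs_add_mul_eq ((hD j hj).1 i)]
        with t ht
      simp only [ht, Finset.sum_add_distrib, ← Finset.mul_sum, (hD j hj).2, hj]
      simp
    · have : Continuous fun t : ℝ => ∑ i, |Y i j + t * D i j| := by fun_prop
      exact (this.tendsto 0).eventually_le_const (by simpa using hj)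
  obtain ⟨r, hr, hball⟩ := Metric.eventually_nhds_iff.1 hev
  have hr2 : dist (r / 2) 0 < r := by
    rw [Real.dist_eq, sub_zero, abs_of_pos (by positivity)]; linarith
  refine ⟨fun i j => r / 2 * D i j, fun h => hD0 ?_, fun i => ?_, fun j => ⟨hball hr2 j, ?_⟩⟩
  · ext i j
    simpa [hr.ne'] using congrFun (congrFun h i) j
  · rw [← Finset.mul_sum, hDrow, mul_zero]
  · simpa [sub_eq_add_neg] using hball (y := -(r / 2)) (by simpa using hr2) j

/-! ### Operators on the cube -/

/-- Representatives, up to sign, of the vertices of the cube, chosen with sum zero. -/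
def cubeVertex : Fin 4 → Fin 3 → ℝ :=
  ![![1, 1, 1], ![1, -1, -1], ![-1, 1, -1], ![-1, -1, 1]]

theorem abs_add_add_add_le {a b c : ℝ} (ha : |a| ≤ 1) (hb : |b| ≤ 1) (hc : |c| ≤ 1) :
    |a + b + c + a * b * c| ≤ 1 + a * b + a * c + b * c := by
  rw [abs_le] at *
  have h1 : 0 ≤ (1 + a) * (1 + b) * (1 + c) :=
    mul_nonneg (mul_nonneg (by linarith) (by linarith)) (by linarith)
  have h2 : 0 ≤ (1 - a) * (1 - b) * (1 - c) :=
    mul_nonneg (mul_nonneg (by linarith) (by linarith)) (by linarith)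
  constructor <;> linarith

/-- The cube is the absolutely convex hull of its four representative vertices. -/
theorem exists_coeff_of_norm_le_one (x : ell ∞ 3) (hx : ‖x‖ ≤ 1) :
    ∃ l : Fin 4 → ℝ, ∑ j, |l j| ≤ 1 ∧ x = ∑ j, l j • WithLp.toLp ∞ (cubeVertex j) := by
  have hi : ∀ i, |x i| ≤ 1 := fun i => (PiLp.norm_apply_le x i).trans hx
  have hi' : ∀ i, |-x i| ≤ 1 := fun i => (abs_neg (x i)).trans_le (hi i)
  have b0 := abs_add_add_add_le (hi 0) (hi 1) (hi 2)
  have b1 := abs_add_add_add_le (hi 0) (hi' 1) (hi' 2)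
  have b2 := abs_add_add_add_le (hi' 0) (hi 1) (hi' 2)
  have b3 := abs_add_add_add_le (hi' 0) (hi' 1) (hi 2)
  -- With weights `∏ (1 + v i * x i) / 8` on the eight vertices `v`, the mean is `x`; each
  -- coefficient is the weight of `v` minus that of `-v`.
  refine ⟨![(x 0 + x 1 + x 2 + x 0 * x 1 * x 2) / 4,
    (x 0 + -x 1 + -x 2 + x 0 * -x 1 * -x 2) / 4, (-x 0 + x 1 + -x 2 + -x 0 * x 1 * -x 2) / 4,
    (-x 0 + -x 1 + x 2 + -x 0 * -x 1 * x 2) / 4], ?_, ?_⟩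
  · simp only [Fin.sum_univ_four, Matrix.cons_val, abs_div, abs_of_pos (zero_lt_four' ℝ)]
    linarith
  · ext i
    fin_cases i <;> simp [Fin.sum_univ_four, cubeVertex] <;> ring

theorem norm_le_one_of_cubeVertex {Z : Type*} [NormedAddCommGroup Z] [NormedSpace ℝ Z]
    {T : ell ∞ 3 →L[ℝ] Z} (h : ∀ j, ‖T (WithLp.toLp ∞ (cubeVertex j))‖ ≤ 1) : ‖T‖ ≤ 1 := by
  refine T.opNorm_le_of_unit_norm zero_le_one fun x hx => ?_
  obtain ⟨l, hl, hxl⟩ := exists_coeff_of_norm_le_one x hx.le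
  rw [hxl, map_sum]
  refine (norm_sum_le _ _).trans (le_trans (Finset.sum_le_sum fun j _ => ?_) hl)
  rw [map_smul, norm_smul]
  exact mul_le_of_le_one_right (norm_nonneg _) (h j)

theorem norm_cubeVertex_le (j : Fin 4) : ‖(WithLp.toLp ∞ (cubeVertex j) : ell ∞ 3)‖ ≤ 1 := by
  rw [PiLp.norm_toLp, pi_norm_le_iff_of_nonneg zero_le_one]
  intro i
  fin_cases j <;> fin_cases i <;> simp [cubeVertex]

theorem sum_cubeVertex : ∑ j, (WithLp.toLp ∞ (cubeVertex j) : ell ∞ 3) = 0 := by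
  ext i
  fin_cases i <;> simp [Fin.sum_univ_four, cubeVertex]

/-- The values at the four representative vertices can be prescribed with sum zero. -/
theorem exists_apply_cubeVertex_eq {D : Fin 3 → Fin 4 → ℝ} (hD : ∀ i, ∑ j, D i j = 0) :
    ∃ B : ell ∞ 3 →L[ℝ] ell 1 3, ∀ i j, B (WithLp.toLp ∞ (cubeVertex j)) i = D i j := by
  refine ⟨LinearMap.toContinuousLinearMap
    -- The vertices have inner products `3` on the diagonal and `-1` off it; the surplus `-1` terms
    -- cancel since the rows of `D` sum to zero.
    { toFun := fun x => WithLp.toLp 1 fun i => (∑ j, D i j * ∑ k, cubeVertex j k * x k) / 4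
      map_add' := fun x y => ?_
      map_smul' := fun c x => ?_ }, fun i j => ?_⟩
  · ext i
    simp [mul_add, Finset.sum_add_distrib, add_div]
  · ext i
    simp only [PiLp.smul_apply, smul_eq_mul, RingHom.id_apply, Finset.mul_sum, mul_div_assoc,
      Finset.sum_div]
    refine Finset.sum_congr rfl fun j _ => Finset.sum_congr rfl fun k _ => by ring
  · have := hD i
    simp only [Fin.sum_univ_four] at this
    fin_cases j <;>
      simp [Fin.sum_univ_four, Fin.sum_univ_three, cubeVertex] <;> linarith

/-! ### Extreme contractions and conclusion -/

/-- An extreme contraction from `ℓ_∞³` to `ℓ_1³` has a vanishing coordinate. -/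
theorem exists_coord_eq_zero_of_isExtremeContraction {T : ell ∞ 3 →L[ℝ] ell 1 3}
    (hT : IsExtremeContraction T) : ∃ k, ∀ x, T x k = 0 := by
  by_contra! hne
  set Y : Fin 3 → Fin 4 → ℝ := fun i j => T (WithLp.toLp ∞ (cubeVertex j)) i with hY
  have hT1 : ‖T‖ ≤ 1 := by simpa using hT.1
  have hcol : ∀ j, ∑ i, |Y i j| ≤ 1 := fun j => by
    have := (T.le_opNorm (WithLp.toLp ∞ (cubeVertex j))).trans
      (mul_le_one₀ hT1 (norm_nonneg _) (norm_cubeVertex_le j))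
    rwa [PiLp.norm_eq_of_L1] at this
  have hrow : ∀ i, ∑ j, Y i j = 0 := fun i => by
    have := congrArg (fun x => T x i) sum_cubeVertex
    simpa [map_sum] using this
  have hY0 : ∀ i, Y i ≠ 0 := by
    intro i hi
    obtain ⟨x, hx⟩ := hne i
    refine hx ?_
    have hx0 : x ≠ 0 := by rintro rfl; simp at hx
    obtain ⟨l, -, hl⟩ := exists_coeff_of_norm_le_one (‖x‖⁻¹ • x)
      (by rw [norm_smul, norm_inv, norm_norm, inv_mul_cancel₀ (norm_ne_zero_iff.2 hx0)])
    have h1 : T (‖x‖⁻¹ • x) i = 0 := by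
      rw [hl, map_sum]
      simp only [map_smul, WithLp.ofLp_sum, Finset.sum_apply, PiLp.smul_apply, smul_eq_mul]
      exact Finset.sum_eq_zero fun j _ => mul_eq_zero_of_right _ (congrFun hi j)
    simpa [hx0] using h1
  obtain ⟨D, hD0, hDrow, hD⟩ :=
    (isPerturbable_of_rows_ne_zero hrow hcol hY0).exists_direction hcol
  obtain ⟨B, hB⟩ := exists_apply_cubeVertex_eq hDrow
  have hadd : ‖T + B‖ ≤ 1 := norm_le_one_of_cubeVertex fun j => by
    rw [PiLp.norm_eq_of_L1]
    simpa [hB, hY] using (hD j).1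
  have hsub : ‖T - B‖ ≤ 1 := norm_le_one_of_cubeVertex fun j => by
    rw [PiLp.norm_eq_of_L1]
    simpa [hB, hY] using (hD j).2
  -- `T` is the midpoint of the contractions `T + B` and `T - B`, so extremality forces `B = 0`,
  -- against `D ≠ 0`.
  have : T + B = T := (mem_extremePoints_iff_left.1 hT).2 _ (by simpa using hadd) (T - B)
    (by simpa using hsub) ⟨1 / 2, 1 / 2, by norm_num, by norm_num, by norm_num, by module⟩
  refine hD0 (funext fun i => funext fun j => ?_)
  rw [← hB, add_eq_left.1 this]
  simp

theorem IsExtremeContraction.norm_eq_one {X Y : Type*} [NormedAddCommGroup X] [NormedSpace ℝ X]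
    [NormedAddCommGroup Y] [NormedSpace ℝ Y] [Nontrivial (X →L[ℝ] Y)] {T : X →L[ℝ] Y}
    (hT : IsExtremeContraction T) : ‖T‖ = 1 := by
  simpa using extremePoints_closedBall_subset_sphere hT

theorem exists_nontrivial_approx_of_isExtremeContraction {T : ell ∞ 3 →L[ℝ] ell 1 3}
    (hT : IsExtremeContraction T) {ε : ℝ} (hε : 0 < ε) :
    ∃ A : ell ∞ 3 →L[ℝ] ell 1 3, IsNontrivialUniformBPBApprox ε T A ∧
      normAttainmentSet T = normAttainmentSet A := by
  obtain ⟨k, hk⟩ := exists_coord_eq_zero_of_isExtremeContraction hT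
  exact exists_nontrivial_approx_of_coord_eq_zero hT.norm_eq_one hk hε

end UniformBPB

theorem mainTheorem9 :
    (∀ T : UniformBPB.ell ∞ 3 →L[ℝ] UniformBPB.ell 1 3, UniformBPB.IsExtremeContraction T →
      ∀ ε : ℝ, 0 < ε → ∃ A : UniformBPB.ell ∞ 3 →L[ℝ] UniformBPB.ell 1 3,
        UniformBPB.IsNontrivialUniformBPBApprox ε T A ∧
          UniformBPB.normAttainmentSet T = UniformBPB.normAttainmentSet A) ∧
    UniformBPB.HasNontrivialNormPreservingUniformBPB
      (UniformBPB.ell ∞ 3) (UniformBPB.ell 1 3) := by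
  refine ⟨fun T hT ε hε => UniformBPB.exists_nontrivial_approx_of_isExtremeContraction hT hε,
    fun T hT _ ε hε => ?_⟩
  by_cases hext : UniformBPB.IsExtremeContraction T
  · exact UniformBPB.exists_nontrivial_approx_of_isExtremeContraction hext hε
  · exact UniformBPB.exists_nontrivial_approx_of_not_isExtremeContraction hT hext hε
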